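/- An action of a group on a set $\Omega$ is $k$-transitive if $|\Omega|\ge k$ and any $k$-tuple of distinct points of $\Omega$ can be carried to any other such $k$-tuple by an element of the group. A group is highly transitive if it admits a faithful action that is $k$-transitive for every $k\in\mathbb N$. Let $Alt(\mathbb N)$ be the group of all finitely supported permutations of $\mathbb N$ that act as even permutations on their supports, and let $F_n$ be the free group of rank $n$. A group $G$ satisfies a mixed identity $w=1$, where $w\in G\ast F_n$, if every homomorphism $G\ast F_n\to G$ that is identical on $G$ sends $w$ to $1$; the identity is non-trivial if $w\ne 1$ in $G\ast F_n$. The group $G$ is mixed identity free (MIF) if it satisfies no non-trivial mixed identity, for any $n$. Two groups containing $G$ are universally equivalent as $G$-groups if the same universal first-order sentences in the language of groups with constants from $G$ hold in both. **Theorem.** Let $G$ be a countable highly transitive group. Then exactly one of the following two conditions holds: (a) $G$ contains a normal subgroup isomorphic to $Alt(\mathbb N)$; (b) $G$ is mixed identity free. Moreover, (b) holds if and only if $G$ and $G\ast F_n$ are universally equivalent as $G$-groups for every $n\in\mathbb N$. -/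

import Mathlib

universe u v

/-- The action of `G` on `Ω` is `k`-transitive: `Ω` has at least `k` points, and any `k`-tuple of
distinct points can be carried to any other one by an element of `G`. -/
def IsKTransitive (G : Type*) (Ω : Type*) [Group G] [MulAction G Ω] (k : ℕ) : Prop :=
  Nonempty (Fin k ↪ Ω) ∧
    ∀ a b : Fin k ↪ Ω, ∃ g : G, ∀ i, g • a i = b i

/-- A group is highly transitive if it admits a faithful action that is `k`-transitive for
all `k`. -/
def IsHighlyTransitive (G : Type u) [Group G] : Prop :=
  ∃ (Ω : Type v) (_ : MulAction G Ω), FaithfulSMul G Ω ∧ ∀ k : ℕ, IsKTransitive G Ω k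

/-- `σ` is supported in the finite set `s` and acts on `s` as an even permutation. -/
def IsEvenOn (σ : Equiv.Perm ℕ) (s : Finset ℕ) : Prop :=
  ∃ τ : Equiv.Perm {x // x ∈ s}, Equiv.Perm.sign τ = 1 ∧ Equiv.Perm.ofSubtype τ = σ

theorem IsEvenOn.mono {σ : Equiv.Perm ℕ} {s t : Finset ℕ} (h : IsEvenOn σ s) (hst : s ⊆ t) :
    IsEvenOn σ t := by
  obtain ⟨τ, hτ, rfl⟩ := h
  have hmem : ∀ x, Equiv.Perm.ofSubtype τ x ≠ x → x ∈ s := by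
    intro x hx
    by_contra hxs
    exact hx (Equiv.Perm.ofSubtype_apply_of_not_mem τ hxs)
  have hinv : ∀ x, Equiv.Perm.ofSubtype τ x ∈ t ↔ x ∈ t := by
    intro x
    by_cases hx : x ∈ s
    · have h1 : Equiv.Perm.ofSubtype τ x ∈ s := by
        rw [Equiv.Perm.ofSubtype_apply_of_mem τ hx]
        exact (τ ⟨x, hx⟩).2
      exact ⟨fun _ => hst hx, fun _ => hst h1⟩
    · rw [Equiv.Perm.ofSubtype_apply_of_not_mem τ hx]
  refine ⟨(Equiv.Perm.ofSubtype τ).subtypePerm hinv, ?_, ?_⟩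
  · rw [← hτ]
    symm
    refine Equiv.Perm.sign_bij (fun x _ => ⟨x.1, hst x.2⟩) ?_ ?_ ?_
    · intro x hx hx'
      ext
      simp
    · intro x y _ _ hxy
      have := congrArg Subtype.val hxy
      exact Subtype.ext this
    · intro y hy
      have hy' : Equiv.Perm.ofSubtype τ y.1 ≠ y.1 := fun h => hy (Subtype.ext h)
      refine ⟨⟨y.1, hmem _ hy'⟩, ?_, rfl⟩
      intro h
      apply hy'
      rw [Equiv.Perm.ofSubtype_apply_of_mem τ (hmem _ hy'), h]
  · exact Equiv.Perm.ofSubtype_subtypePerm hinv fun x hx => hst (hmem x hx)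

/-- The infinite alternating group `Alt(ℕ)`: all finitary permutations of `ℕ` that act as even
permutations on their supports (equivalently, on a finite set containing the support). -/
def altNat : Subgroup (Equiv.Perm ℕ) where
  carrier := {σ | ∃ s : Finset ℕ, IsEvenOn σ s}
  one_mem' := ⟨∅, 1, by simp, by simp⟩
  mul_mem' := by
    rintro σ σ' ⟨s, hs⟩ ⟨t, ht⟩
    obtain ⟨τ, hτ, h1⟩ := hs.mono (Finset.subset_union_left (s₂ := t))
    obtain ⟨τ', hτ', h2⟩ := ht.mono (Finset.subset_union_right (s₁ := s))
    exact ⟨s ∪ t, τ * τ', by rw [map_mul, hτ, hτ', one_mul], by rw [map_mul, h1, h2]⟩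
  inv_mem' := by
    rintro σ ⟨s, τ, hτ, h1⟩
    exact ⟨s, τ⁻¹, by rw [map_inv, hτ, inv_one], by rw [map_inv, h1]⟩

/-- `G` satisfies the mixed identity `w = 1`, where `w ∈ G ∗ Fₙ`: every homomorphism
`G ∗ Fₙ → G` that is identical on `G` sends `w` to `1`. -/
def SatisfiesMixedIdentity (G : Type*) [Group G] {n : ℕ}
    (w : Monoid.Coprod G (FreeGroup (Fin n))) : Prop :=
  ∀ f : Monoid.Coprod G (FreeGroup (Fin n)) →* G,
    (∀ g : G, f (Monoid.Coprod.inl g) = g) → f w = 1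

/-- `G` is mixed identity free: it satisfies no non-trivial mixed identity. -/
def IsMIF (G : Type*) [Group G] : Prop :=
  ∀ (n : ℕ) (w : Monoid.Coprod G (FreeGroup (Fin n))), w ≠ 1 → ¬ SatisfiesMixedIdentity G w

/-- Function symbols of the language of `G`-groups: multiplication, inversion, and a constant for
each element of `G`. -/
inductive GGroupFunc (G : Type u) : ℕ → Type u
  | const (g : G) : GGroupFunc G 0
  | inv : GGroupFunc G 1
  | mul : GGroupFunc G 2

/-- The first order language of `G`-groups (equality is logical; no relation symbols). -/
def gGroupLanguage (G : Type u) : FirstOrder.Language.{u, 0} where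
  Functions := GGroupFunc G
  Relations := fun _ => Empty

/-- A group `H` with a homomorphism (an embedding, for a `G`-group) `ι : G → H`, as a structure in
the language of `G`-groups. -/
@[reducible] def gGroupStructure {G H : Type*} [Group G] [Group H] (ι : G →* H) :
    (gGroupLanguage G).Structure H where
  funMap
    | .const g, _ => ι g
    | .inv, x => (x 0)⁻¹
    | .mul, x => x 0 * x 1
  RelMap := fun r _ => r.elim

/-- The universal theory of `H`, as a `G`-group through `ι`: all universal sentences (universal
quantifiers followed by a quantifier-free formula) in the language of `G`-groups true in `H`. -/
def universalTheory {G H : Type*} [Group G] [Group H] (ι : G →* H) :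
    Set (gGroupLanguage G).Sentence :=
  letI := gGroupStructure ι
  {φ | FirstOrder.Language.BoundedFormula.IsUniversal φ ∧ H ⊨ φ}

/-- Universal equivalence as `G`-groups. -/
def UniversallyEquivalent {G H₁ H₂ : Type*} [Group G] [Group H₁] [Group H₂]
    (ι₁ : G →* H₁) (ι₂ : G →* H₂) : Prop :=
  universalTheory ι₁ = universalTheory ι₂

/-!
Let `G` act faithfully and highly transitively on `Ω`. The proof turns on whether `G` contains a
non-trivial finitary element, one that moves only finitely many points of `Ω`.

* If it does, the quotient of such an element by its conjugate under a suitable transposition is a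
  `3`-cycle; the conjugation is available inside `G` because conjugating a finitary element only
  involves finitely many values (`conj_mem_of_finitary`). By `3`-transitivity all `3`-cycles lie in
  `G`, hence so does the whole finitary alternating group, which is normal
  (`exists_altNat_or_hasInfiniteSupports`).

* If it does not, every non-trivial element moves infinitely many points. A reduced word
  `g₀ x^{±1} g₁ x^{±1} ⋯` in `G ∗ F` is then made to move a point by following a trajectory: each
  letter sends the current point to an unused point, chosen such that the next coefficient carries it
  to an unused point, or fixes it where this causes no cancellation (`exists_trajectory`). Only
  finitely many values of the generators are prescribed, and high transitivity realizes them in `G`.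
  The prescriptions for finitely many words can be accumulated, so finitely many non-trivial elements
  of `G ∗ F` survive under a common `G`-homomorphism to `G` (`exists_lift_ne_one`). For one element
  this says that `G` is mixed identity free; for several, it says that a universal sentence which
  fails in `G ∗ F` fails in `G` (`exists_finset_not_realize_of_isUniversal`).

The two cases exclude each other for abstract reasons: if `N ≅ Alt(ℕ)` is normal in `G` and `n ∈ N`
is non-trivial, then `ν = y n y⁻¹` is in `N` for all `y ∈ G`, and the finitary permutation
`ν n ν⁻¹ n` moves at most twice as many points as `n`, so its order is bounded
(`not_isMIF_of_altNat`). That the resulting mixed identity is non-trivial is again a trajectory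
argument, applied to the free action of `G` on itself and to generators in the full symmetric group
of `G` (`ofSyllables_ne_one`), so no normal form theorem for free products is needed.

Finally, a mixed identity is a universal sentence, and evaluating it at the free generators of
`G ∗ F_n` shows that universal equivalence forces `G` to be mixed identity free.
-/

namespace HighlyTransitive

open Monoid.Coprod (inl inr lift)

/-! ### Words in a free product with a free group -/

section Words

variable {G H ι : Type*} [Group G] [Group H]

/-- The value of the letter `x i` (if `b = true`) or `(x i)⁻¹` (if `b = false`). -/
def letter (x : ι → H) (i : ι) (b : Bool) : H := cond b (x i) (x i)⁻¹

/-- A list of syllables `(i, b, g)`, standing for `(x i)^{±1} * g` with the sign given by `b`,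
evaluated at `x : ι → H`, the coefficients being mapped to `H` by `φ`. -/
def syllableProd (φ : G →* H) (x : ι → H) : List (ι × Bool × G) → H
  | [] => 1
  | (i, b, g) :: L => letter x i b * φ g * syllableProd φ x L

/-- No cancellation between two consecutive syllables: `(x i)^{±1} * g * (x i)^{∓1}` is allowed only
if `g ≠ 1`. -/
def NoCancel (s t : ι × Bool × G) : Prop :=
  s.1 = t.1 → s.2.1 = !t.2.1 → s.2.2 ≠ 1

theorem map_syllableProd {K : Type*} [Group K] (f : H →* K) (φ : G →* H) (x : ι → H)
    (L : List (ι × Bool × G)) :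
    f (syllableProd φ x L) = syllableProd (f.comp φ) (f ∘ x) L := by
  induction L with
  | nil => simp [syllableProd]
  | cons s L ih =>
    obtain ⟨i, b, g⟩ := s
    cases b <;> simp [syllableProd, letter, ih]

theorem syllableProd_append (φ : G →* H) (x : ι → H) (L M : List (ι × Bool × G)) :
    syllableProd φ x (L ++ M) = syllableProd φ x L * syllableProd φ x M := by
  induction L with
  | nil => simp [syllableProd]
  | cons s L ih =>
    obtain ⟨i, b, g⟩ := s
    simp [syllableProd, ih, mul_assoc]

theorem syllableProd_flatten_replicate (φ : G →* H) (x : ι → H) (L : List (ι × Bool × G))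
    (k : ℕ) :
    syllableProd φ x (List.replicate k L).flatten = syllableProd φ x L ^ k := by
  induction k with
  | zero => simp [syllableProd]
  | succ k ih => simp [List.replicate_succ, syllableProd_append, ih, pow_succ']

/-- The free generators, as elements of `G ∗ F(ι)`. -/
def gen (G : Type*) [Group G] {ι : Type*} (i : ι) : Monoid.Coprod G (FreeGroup ι) :=
  inr (FreeGroup.of i)

/-- The element of `G ∗ F(ι)` with the given initial coefficient and syllables. -/
def ofSyllables (g : G) (L : List (ι × Bool × G)) : Monoid.Coprod G (FreeGroup ι) :=
  inl g * syllableProd inl (gen G) L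

theorem lift_ofSyllables (φ : G →* H) (x : ι → H) (g : G) (L : List (ι × Bool × G)) :
    lift φ (FreeGroup.lift x) (ofSyllables g L) = φ g * syllableProd φ x L := by
  rw [ofSyllables, map_mul, map_syllableProd, Monoid.Coprod.lift_comp_inl,
    Monoid.Coprod.lift_apply_inl]
  congr 2
  funext i
  simp [gen]

theorem letter_mul_letter_not (x : ι → H) (i : ι) (b : Bool) :
    letter x i (!b) * letter x i b = 1 := by
  cases b <;> simp [letter]

/-- Multiplying by a letter on the left preserves the existence of a reduced expression: either the
letter cancels or the expression stays reduced. -/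
theorem exists_reduced_letter_mul (i : ι) (b : Bool) (g : G) (L : List (ι × Bool × G))
    (hL : L.IsChain NoCancel) :
    ∃ (g' : G) (L' : List (ι × Bool × G)), L'.IsChain NoCancel ∧
      ofSyllables g' L' = letter (gen G) i b * ofSyllables g L := by
  have key : ∀ g L, ofSyllables 1 ((i, b, g) :: L) =
      letter (gen G) i b * (ofSyllables g L : Monoid.Coprod G (FreeGroup ι)) := by
    intro g L
    simp [ofSyllables, syllableProd, mul_assoc]
  cases L with
  | nil => exact ⟨1, [(i, b, g)], List.isChain_singleton _, key _ _⟩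
  | cons t L =>
    by_cases hc : NoCancel (i, b, g) t
    · exact ⟨1, (i, b, g) :: t :: L, List.isChain_cons_cons.2 ⟨hc, hL⟩, key _ _⟩
    · obtain ⟨j, c, h⟩ := t
      simp only [NoCancel, not_forall, not_not] at hc
      obtain ⟨rfl, rfl, rfl⟩ := hc
      refine ⟨h, L, hL.tail, ?_⟩
      simp only [ofSyllables, syllableProd, map_one, one_mul, ← mul_assoc,
        letter_mul_letter_not]

theorem exists_reduced (w : Monoid.Coprod G (FreeGroup ι)) :
    ∃ (g : G) (L : List (ι × Bool × G)), L.IsChain NoCancel ∧ ofSyllables g L = w := by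
  let P : Monoid.Coprod G (FreeGroup ι) → Prop := fun w =>
    ∃ (g : G) (L : List (ι × Bool × G)), L.IsChain NoCancel ∧ ofSyllables g L = w
  suffices h : ∀ u w, P w → P (u * w) by
    simpa using h w 1 ⟨1, [], List.isChain_nil, by simp [ofSyllables, syllableProd]⟩
  intro u
  induction u using Monoid.Coprod.induction_on with
  | inl h =>
    rintro _ ⟨g, L, hL, rfl⟩
    exact ⟨h * g, L, hL, by simp [ofSyllables, mul_assoc]⟩
  | inr f =>
    induction f using FreeGroup.induction_on with
    | C1 => intro w hw; simpa using hw
    | of i =>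
      rintro _ ⟨g, L, hL, rfl⟩
      exact exists_reduced_letter_mul i true g L hL
    | inv_of i _ =>
      rintro _ ⟨g, L, hL, rfl⟩
      rw [map_inv]
      exact exists_reduced_letter_mul i false g L hL
    | mul a b ha hb =>
      intro w hw
      rw [map_mul, mul_assoc]
      exact ha _ (hb _ hw)
  | mul a b ha hb =>
    intro w hw
    rw [mul_assoc]
    exact ha _ (hb _ hw)

end Words

/-! ### Finite partial injections and separation of words -/

section Paths

variable {G H ι Ω : Type*} [Group G] [Group H] [MulAction H Ω]

/-- A finite set of triples `(i, a, b)`, each prescribing that the `i`-th element carries `a` to `b`,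
is a family of partial injections. -/
def IsPartialInj (R : Finset (ι × Ω × Ω)) : Prop :=
  ∀ i a b a' b', (i, a, b) ∈ R → (i, a', b') ∈ R → (a = a' ↔ b = b')

/-- The elements `x i` act as prescribed by `R`. -/
def Realizes (x : ι → H) (R : Finset (ι × Ω × Ω)) : Prop :=
  ∀ i a b, (i, a, b) ∈ R → x i • a = b

theorem Realizes.mono {x : ι → H} {R S : Finset (ι × Ω × Ω)} (h : Realizes x S) (hRS : R ⊆ S) :
    Realizes x R := fun i a b hab => h i a b (hRS hab)

/-- High transitivity realizes every finite partial injection. -/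
theorem exists_realizes (hH : ∀ k, IsKTransitive H Ω k) (R : Finset (ι × Ω × Ω))
    (hR : IsPartialInj R) : ∃ x : ι → H, Realizes x R := by
  classical
  have : ∀ i, ∃ y : H, ∀ a b, (i, a, b) ∈ R → y • a = b := by
    intro i
    let S := R.filter (fun t => t.1 = i)
    have hS : ∀ t ∈ S, t.1 = i ∧ t ∈ R := fun t ht => by
      rw [Finset.mem_filter] at ht
      exact ⟨ht.2, ht.1⟩
    let e := S.equivFin
    have inj : ∀ s t : S, (s.1.2.1 = t.1.2.1 ↔ s.1.2.2 = t.1.2.2) := by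
      rintro ⟨⟨j, a, b⟩, hs⟩ ⟨⟨j', a', b'⟩, ht⟩
      obtain ⟨h1, h2⟩ := hS _ hs
      obtain ⟨h3, h4⟩ := hS _ ht
      dsimp only at h1 h3
      subst h1 h3
      exact hR _ _ _ _ _ h2 h4
    have ext : ∀ s t : S, s.1.2.1 = t.1.2.1 → s.1.2.2 = t.1.2.2 → s = t := fun s t h h' =>
      Subtype.ext (Prod.ext ((hS _ s.2).1.trans (hS _ t.2).1.symm) (Prod.ext h h'))
    obtain ⟨y, hy⟩ := (hH S.card).2
      ⟨fun k => (e.symm k).1.2.1, fun k l h => e.symm.injective (ext _ _ h ((inj _ _).1 h))⟩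
      ⟨fun k => (e.symm k).1.2.2, fun k l h => e.symm.injective (ext _ _ ((inj _ _).2 h) h)⟩
    refine ⟨y, fun a b hab => ?_⟩
    have := hy (e ⟨(i, a, b), Finset.mem_filter.2 ⟨hab, rfl⟩⟩)
    dsimp only [DFunLike.coe] at this
    simpa using this
  choose x hx using this
  exact ⟨x, fun i a b => hx i a b⟩

theorem infinite_of_isKTransitive (hH : ∀ k, IsKTransitive H Ω k) : Infinite Ω := by
  by_contra hfin
  rw [not_infinite_iff_finite] at hfin
  have := Fintype.ofFinite Ω
  obtain ⟨f⟩ := (hH (Fintype.card Ω + 1)).1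
  have := Fintype.card_le_of_embedding f
  simp at this

/-- The set `R` does not yet prescribe the image of `r` under the `i`-th element (if `b = true`) or
under its inverse (if `b = false`). -/
def IsFresh (R : Finset (ι × Ω × Ω)) (i : ι) (r : Ω) (b : Bool) : Prop :=
  ∀ c, cond b (i, r, c) (i, c, r) ∉ R

/-- The triple prescribing that the letter `(i, b)` carries `r` to `q`. -/
def letterTriple (i : ι) (b : Bool) (r q : Ω) : ι × Ω × Ω := cond b (i, r, q) (i, q, r)

theorem Realizes.letter_smul {x : ι → H} {R : Finset (ι × Ω × Ω)} (h : Realizes x R) {i : ι}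
    {b : Bool} {r q : Ω} (hm : letterTriple i b r q ∈ R) : letter x i b • r = q := by
  cases b with
  | true => exact h i r q hm
  | false => exact inv_smul_eq_iff.2 (h i q r hm).symm

/-- All points that occur in `R`. -/
def points [DecidableEq Ω] (R : Finset (ι × Ω × Ω)) : Finset Ω :=
  R.image (fun t => t.2.1) ∪ R.image (fun t => t.2.2)

theorem left_mem_points [DecidableEq Ω] {R : Finset (ι × Ω × Ω)} {i : ι} {a b : Ω}
    (h : (i, a, b) ∈ R) : a ∈ points R :=
  Finset.mem_union_left _ (Finset.mem_image_of_mem (fun t : ι × Ω × Ω => t.2.1) h)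

theorem right_mem_points [DecidableEq Ω] {R : Finset (ι × Ω × Ω)} {i : ι} {a b : Ω}
    (h : (i, a, b) ∈ R) : b ∈ points R :=
  Finset.mem_union_right _ (Finset.mem_image_of_mem (fun t : ι × Ω × Ω => t.2.2) h)

theorem isFresh_of_notMem_points [DecidableEq Ω] {R : Finset (ι × Ω × Ω)} {r : Ω}
    (h : r ∉ points R) (i : ι) (b : Bool) : IsFresh R i r b := by
  intro c
  cases b with
  | true => exact fun hm => h (left_mem_points hm)
  | false => exact fun hm => h (right_mem_points hm)

theorem IsPartialInj.insert_letterTriple [DecidableEq ι] [DecidableEq Ω]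
    {R : Finset (ι × Ω × Ω)} (hR : IsPartialInj R) {i : ι} {b : Bool} {r q : Ω}
    (hr : IsFresh R i r b) (hq : q ∉ points R) :
    IsPartialInj (insert (letterTriple i b r q) R) := by
  have hq1 : ∀ j c, (j, q, c) ∉ R := fun j c h => hq (left_mem_points h)
  have hq2 : ∀ j c, (j, c, q) ∉ R := fun j c h => hq (right_mem_points h)
  intro j a c a' c' h h'
  rw [Finset.mem_insert] at h h'
  cases b with
  | true =>
    simp only [letterTriple, cond_true, Prod.mk.injEq, IsFresh] at h h' hr
    rcases h with ⟨rfl, rfl, rfl⟩ | h <;> rcases h' with ⟨h1, h2, h3⟩ | h'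
    · simp [h2, h3]
    · exact ⟨fun e => absurd (e ▸ h') (hr _), fun e => absurd (e ▸ h') (hq2 _ _)⟩
    · subst h1 h2 h3
      exact ⟨fun e => absurd (e ▸ h) (hr _), fun e => absurd (e ▸ h) (hq2 _ _)⟩
    · exact hR _ _ _ _ _ h h'
  | false =>
    simp only [letterTriple, cond_false, Prod.mk.injEq, IsFresh] at h h' hr
    rcases h with ⟨rfl, rfl, rfl⟩ | h <;> rcases h' with ⟨h1, h2, h3⟩ | h'
    · simp [h2, h3]
    · exact ⟨fun e => absurd (e ▸ h') (hq1 _ _), fun e => absurd (e ▸ h') (hr _)⟩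
    · subst h1 h2 h3
      exact ⟨fun e => absurd (e ▸ h) (hq1 _ _), fun e => absurd (e ▸ h) (hr _)⟩
    · exact hR _ _ _ _ _ h h'

/-- Every non-trivial element moves infinitely many points. -/
def HasInfiniteSupports (φ : G →* H) (Ω : Type*) [MulAction H Ω] : Prop :=
  ∀ g : G, g ≠ 1 → {q : Ω | φ g • q ≠ q}.Infinite

/-- There is an unused point which `h` carries to an unused point, and which `h` moves if `h ≠ 1`. -/
theorem HasInfiniteSupports.exists_generic [Infinite Ω] {φ : G →* H}
    (hφ : HasInfiniteSupports φ Ω) (h : G) (F : Finset Ω) :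
    ∃ q, q ∉ F ∧ φ h • q ∉ F ∧ (h ≠ 1 → φ h • q ≠ q) := by
  have hfin : ((F : Set Ω) ∪ (φ h • ·) ⁻¹' (F : Set Ω)).Finite :=
    F.finite_toSet.union (F.finite_toSet.preimage (MulAction.injective (φ h)).injOn)
  have hinf : {q : Ω | h ≠ 1 → φ h • q ≠ q}.Infinite := by
    by_cases h1 : h = 1
    · simpa [h1] using Set.infinite_univ
    · simpa [h1] using hφ h h1
  obtain ⟨q, hq, hq'⟩ := (hinf.sdiff hfin).nonempty
  simp only [Set.mem_union, not_or] at hq'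
  exact ⟨q, hq'.1, hq'.2, hq⟩

/-- The trajectory of a point under a reduced word, built syllable by syllable from the right. Just
before the leftmost letter `(i, b)` acts, the trajectory is at a point `r` at which that letter is not
yet prescribed, so it may still be sent to any unused point. -/
theorem exists_trajectory [Infinite Ω] {φ : G →* H} (hφ : HasInfiniteSupports φ Ω)
    (L : List (ι × Bool × G)) (i : ι) (b : Bool) (g : G)
    (hL : ((i, b, g) :: L).IsChain NoCancel) (R₀ : Finset (ι × Ω × Ω)) (hR₀ : IsPartialInj R₀) :
    ∃ R, R₀ ⊆ R ∧ IsPartialInj R ∧ ∃ p r : Ω, IsFresh R i r b ∧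
      ∀ x : ι → H, Realizes x R → (φ g * syllableProd φ x L) • p = r := by
  classical
  induction L generalizing i b g with
  | nil =>
    obtain ⟨p, -, hp, -⟩ := hφ.exists_generic g (points R₀)
    exact ⟨R₀, subset_rfl, hR₀, p, φ g • p, isFresh_of_notMem_points hp i b,
      fun x _ => by simp [syllableProd]⟩
  | cons t L ih =>
    obtain ⟨j, c, h⟩ := t
    obtain ⟨hc, hL⟩ := List.isChain_cons_cons.1 hL
    obtain ⟨R, hsub, hR, p, r, hr, hp⟩ := ih j c h hL
    obtain ⟨q, hq, hgq, hne⟩ := hφ.exists_generic g (insert r (points R))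
    rw [Finset.mem_insert, not_or] at hq hgq
    refine ⟨insert (letterTriple j c r q) R, hsub.trans (Finset.subset_insert _ _),
      hR.insert_letterTriple hr hq.2, p, φ g • q, ?_, fun x hx => ?_⟩
    · intro d hd
      rcases Finset.mem_insert.1 hd with hd | hd
      · -- The new triple can only obstruct if `g` fixes `q` and the two letters are inverse.
        cases b <;> cases c <;>
          simp only [letterTriple, cond_true, cond_false, Prod.mk.injEq] at hd
        · exact hgq.1 hd.2.2
        · exact hne (hc hd.1 rfl) hd.2.2
        · exact hne (hc hd.1 rfl) hd.2.1
        · exact hgq.1 hd.2.1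
      · exact isFresh_of_notMem_points hgq.2 i b d hd
    · have h1 := hp x (hx.mono (Finset.subset_insert _ _))
      have h2 := hx.letter_smul (Finset.mem_insert_self _ _)
      simp only [syllableProd, mul_smul] at h1 ⊢
      rw [h1, h2]

/-- A reduced word moves a point, for all choices of the generators extending some finite partial
injections, which can be chosen to extend any given ones. -/
theorem exists_forall_realizes_ne_one [Infinite Ω] {φ : G →* H}
    (hφ : HasInfiniteSupports φ Ω) (g : G) (L : List (ι × Bool × G)) (hL : L.IsChain NoCancel)
    (hgL : L = [] → g ≠ 1) (R₀ : Finset (ι × Ω × Ω)) (hR₀ : IsPartialInj R₀) :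
    ∃ R, R₀ ⊆ R ∧ IsPartialInj R ∧
      ∀ x : ι → H, Realizes x R → φ g * syllableProd φ x L ≠ 1 := by
  classical
  cases L with
  | nil =>
    obtain ⟨q, hq⟩ := (hφ g (hgL rfl)).nonempty
    refine ⟨R₀, subset_rfl, hR₀, fun x _ h1 => hq ?_⟩
    simp only [syllableProd, mul_one] at h1
    simp [h1]
  | cons t L =>
    obtain ⟨i, b, h⟩ := t
    obtain ⟨R, hsub, hR, p, r, hr, hp⟩ := exists_trajectory hφ L i b h hL R₀ hR₀
    obtain ⟨q, hq, hgq, -⟩ := hφ.exists_generic g (insert p (points R))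
    rw [Finset.mem_insert, not_or] at hq hgq
    refine ⟨insert (letterTriple i b r q) R, hsub.trans (Finset.subset_insert _ _),
      hR.insert_letterTriple hr hq.2, fun x hx h1 => hgq.1 ?_⟩
    have h2 := hp x (hx.mono (Finset.subset_insert _ _))
    have h3 := hx.letter_smul (Finset.mem_insert_self _ _)
    have h4 : (φ g * syllableProd φ x ((i, b, h) :: L)) • p = p := by rw [h1, one_smul]
    simp only [syllableProd, mul_smul] at h2 h4
    rw [h2, h3] at h4
    exact h4

/-- Finitely many non-trivial elements of `G ∗ F(ι)` survive simultaneously under a suitable choice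
of the images of the free generators: prescriptions for one word extend those for the others. -/
theorem exists_lift_ne_one (hH : ∀ k, IsKTransitive H Ω k) {φ : G →* H}
    (hφ : HasInfiniteSupports φ Ω) (W : Finset (Monoid.Coprod G (FreeGroup ι)))
    (hW : ∀ w ∈ W, w ≠ 1) :
    ∃ x : ι → H, ∀ w ∈ W, lift φ (FreeGroup.lift x) w ≠ 1 := by
  classical
  have := infinite_of_isKTransitive hH
  suffices h : ∃ R : Finset (ι × Ω × Ω), IsPartialInj R ∧
      ∀ x : ι → H, Realizes x R → ∀ w ∈ W, lift φ (FreeGroup.lift x) w ≠ 1 by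
    obtain ⟨R, hR, h⟩ := h
    obtain ⟨x, hx⟩ := exists_realizes hH R hR
    exact ⟨x, h x hx⟩
  induction W using Finset.induction_on with
  | empty => exact ⟨∅, by simp [IsPartialInj], by simp⟩
  | insert w W _ ih =>
    obtain ⟨R₀, hR₀, h₀⟩ := ih fun w hw => hW w (Finset.mem_insert_of_mem hw)
    have hw := hW w (Finset.mem_insert_self _ _)
    obtain ⟨g, L, hL, rfl⟩ := exists_reduced w
    obtain ⟨R, hsub, hR, h⟩ := exists_forall_realizes_ne_one hφ g L hL
      (fun hnil hg => hw (by simp [hnil, hg, ofSyllables, syllableProd])) R₀ hR₀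
    refine ⟨R, hR, fun x hx w' hw' => ?_⟩
    rcases Finset.mem_insert.1 hw' with rfl | hw'
    · rw [lift_ofSyllables]
      exact h x hx
    · exact h₀ x (hx.mono hsub) w' hw'

end Paths

/-- The full symmetric group of an infinite set is highly transitive. -/
theorem isKTransitive_perm (Ω : Type*) [Infinite Ω] (k : ℕ) :
    IsKTransitive (Equiv.Perm Ω) Ω k := by
  refine ⟨⟨Fin.valEmbedding.trans (Infinite.natEmbedding Ω)⟩, fun a b => ?_⟩
  obtain ⟨σ, hσ⟩ := Equiv.Perm.exists_extending_pair a b a.injective b.injective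
  exact ⟨σ, fun i => hσ i⟩

/-- Over an infinite group, a non-empty reduced word represents a non-trivial element of the free
product: it acts non-trivially on `G`, on which `G` acts freely by left translations and the free
generators by suitable permutations. -/
theorem ofSyllables_ne_one {G ι : Type*} [Group G] [Infinite G] (g : G)
    (L : List (ι × Bool × G)) (hL : L.IsChain NoCancel) (hne : L ≠ []) : ofSyllables g L ≠ 1 := by
  classical
  have hφ : HasInfiniteSupports (MulAction.toPermHom G G) G := by
    intro g hg
    have : {q : G | MulAction.toPermHom G G g • q ≠ q} = Set.univ := by
      ext q
      simpa using hg
    rw [this]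
    exact Set.infinite_univ
  obtain ⟨R, -, hR, h⟩ := exists_forall_realizes_ne_one hφ g L hL (fun h => absurd h hne) ∅
    (by simp [IsPartialInj])
  obtain ⟨x, hx⟩ := exists_realizes (isKTransitive_perm G) R hR
  intro h1
  refine h x hx ?_
  rw [← lift_ofSyllables, h1, map_one]

/-- A highly transitive action without non-trivial finitary elements makes the group mixed identity
free. -/
theorem isMIF_of_hasInfiniteSupports {G Ω : Type*} [Group G] [MulAction G Ω]
    (hG : ∀ k, IsKTransitive G Ω k) (hφ : HasInfiniteSupports (MonoidHom.id G) Ω) : IsMIF G := by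
  intro n w hw h
  obtain ⟨x, hx⟩ := exists_lift_ne_one hG hφ {w} (by simpa using hw)
  exact hx w (Finset.mem_singleton_self w) (h _ fun g => by simp)

/-! ### Finitary permutations in a highly transitive group -/

section Finitary

open Equiv Equiv.Perm

variable {α : Type*} [DecidableEq α]

/-- For a finitary element `g` of a group that is highly transitive on `α`, the conjugate `π * g * π⁻¹`
depends only on the values of `π` on the support of `g`, so `π` may be replaced by an element of the
group. -/
theorem conj_mem_of_finitary {P : Subgroup (Perm α)} (hP : ∀ k, IsKTransitive P α k) {g : Perm α}
    (hg : g ∈ P) {S : Finset α} (hS : ∀ x ∉ S, g x = x) (π : Perm α) : π * g * π⁻¹ ∈ P := by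
  obtain ⟨⟨h, hh⟩, hS'⟩ := (hP S.card).2
    (S.equivFin.symm.toEmbedding.trans (Function.Embedding.subtype _))
    ((S.equivFin.symm.toEmbedding.trans (Function.Embedding.subtype _)).trans π.toEmbedding)
  have hπ : ∀ x ∈ S, h x = π x := by
    intro x hx
    simpa [Subgroup.smul_def] using hS' (S.equivFin ⟨x, hx⟩)
  have hgS : ∀ x ∈ S, g x ∈ S := by
    intro x hx
    by_contra hgx
    have := g.injective (hS _ hgx)
    exact hgx (by rwa [this])
  suffices π * g * π⁻¹ = h * g * h⁻¹ by
    rw [this]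
    exact P.mul_mem (P.mul_mem hh hg) (P.inv_mem hh)
  have hk : ∀ x ∈ S, (h⁻¹ * π) x = x := by
    intro x hx
    rw [Perm.mul_apply, Perm.inv_eq_iff_eq, hπ x hx]
  have hcomm : h⁻¹ * π * g = g * (h⁻¹ * π) := by
    ext1 x
    rw [Perm.mul_apply, Perm.mul_apply g]
    by_cases hx : x ∈ S
    · rw [hk x hx, hk _ (hgS x hx)]
    · have hx' : (h⁻¹ * π) x ∉ S := by
        intro hx'
        have := (h⁻¹ * π).injective (hk _ hx')
        exact hx (by rwa [this] at hx')
      rw [hS x hx, hS _ hx']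
  calc π * g * π⁻¹ = h * (h⁻¹ * π * g) * π⁻¹ := by group
    _ = h * g * h⁻¹ := by rw [hcomm]; group

/-- A highly transitive group containing a non-trivial finitary permutation contains all
`3`-cycles. -/
theorem swap_mul_swap_mem_of_ne [Infinite α] {P : Subgroup (Perm α)}
    (hP : ∀ k, IsKTransitive P α k) {g : Perm α} (hg : g ∈ P) (hg1 : g ≠ 1) {S : Finset α}
    (hS : ∀ x ∉ S, g x = x) {x y z : α} (hxy : x ≠ y) (hzy : z ≠ y) (hxz : x ≠ z) :
    swap x y * swap z y ∈ P := by
  obtain ⟨b, hb⟩ : ∃ b, g b ≠ b := by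
    by_contra! h
    exact hg1 (Perm.ext h)
  obtain ⟨c, hc⟩ := Infinite.exists_notMem_finset S
  have hbS : b ∈ S := by
    by_contra h
    exact hb (hS b h)
  have hbc : b ≠ c := fun h => hc (h ▸ hbS)
  have hgb : g b ≠ c := fun h => hbc (g.injective (h.trans (hS c hc).symm))
  -- The quotient of `g` by its conjugate under the transposition of the moved point `g b` and the
  -- fixed point `c` is a `3`-cycle.
  have h3 : swap b c * swap (g b) c ∈ P := by
    -- As `c` is fixed by `g`, this quotient is `swap b c * swap (g b) c`.
    have h1 := P.mul_mem (P.inv_mem hg) (conj_mem_of_finitary hP hg hS (swap (g b) c))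
    have h2 : swap (g b) c * g = g * swap b c := by
      conv_lhs => rw [← hS c hc]
      rw [Equiv.mul_swap_eq_swap_mul]
    rwa [h2, swap_inv, mul_assoc, inv_mul_cancel_left] at h1
  have inj : ∀ {u v w : α}, u ≠ v → w ≠ v → u ≠ w → Function.Injective ![u, v, w] := by
    intro u v w h1 h2 h3 i j h
    fin_cases i <;> fin_cases j <;> simp_all
  obtain ⟨⟨h, hh⟩, hmap⟩ := (hP 3).2 ⟨_, inj hbc hgb hb.symm⟩ ⟨_, inj hxy hzy hxz⟩
  have e0 : h b = x := hmap 0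
  have e1 : h c = y := hmap 1
  have e2 : h (g b) = z := hmap 2
  have h4 : swap x y * swap z y = h * (swap b c * swap (g b) c) * h⁻¹ := by
    rw [eq_mul_inv_iff_mul_eq, ← mul_assoc h, Equiv.mul_swap_eq_swap_mul h, mul_assoc _ h,
      Equiv.mul_swap_eq_swap_mul h, e0, e1, e2, mul_assoc]
  rw [h4]
  exact P.mul_mem (P.mul_mem hh h3) (P.inv_mem hh)

theorem swap_mul_swap_mem [Infinite α] {P : Subgroup (Perm α)}
    (h3 : ∀ x y z : α, x ≠ y → z ≠ y → x ≠ z → swap x y * swap z y ∈ P) {a b c d : α}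
    (hab : a ≠ b) (hcd : c ≠ d) : swap a b * swap c d ∈ P := by
  have key : ∀ x y z : α, x ≠ y → z ≠ y → swap x y * swap z y ∈ P := by
    intro x y z hxy hzy
    by_cases hxz : x = z
    · simp [hxz]
    · exact h3 x y z hxy hzy hxz
  by_cases hbd : b = d
  · subst hbd
    exact key _ _ _ hab hcd
  · have h1 := key a b d hab (Ne.symm hbd)
    have h2 := key b d c hbd hcd
    have := P.mul_mem h1 h2
    rwa [swap_comm d b, mul_assoc, swap_mul_self_mul] at this

/-- A group of permutations containing all products of two transpositions contains all finitary
permutations that are even on a finite set. -/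
theorem altNat_le {P : Subgroup (Perm ℕ)}
    (h : ∀ a b c d : ℕ, a ≠ b → c ≠ d → swap a b * swap c d ∈ P) : altNat ≤ P := by
  rintro σ ⟨s, τ, hτ, rfl⟩
  -- Induction on a factorization of `τ` into transpositions, treating the odd case simultaneously.
  suffices hs : (sign τ = 1 → ofSubtype τ ∈ P) ∧
      (sign τ = -1 → ∀ a b : ℕ, a ≠ b → swap a b * ofSubtype τ ∈ P) from hs.1 hτ
  clear hτ
  induction τ using swap_induction_on with
  | one => exact ⟨fun _ => by simp [P.one_mem], fun h1 => by simp at h1⟩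
  | swap_mul f x y hxy ih =>
    have hsub : (x : ℕ) ≠ y := fun e => hxy (Subtype.ext e)
    rw [map_mul, map_mul, sign_swap hxy, ofSubtype_swap_eq]
    refine ⟨fun h1 => ih.2 ?_ _ _ hsub, fun h1 a b hab => ?_⟩
    · rw [neg_one_mul] at h1
      rw [← h1, neg_neg]
    · rw [neg_one_mul, neg_inj] at h1
      rw [← mul_assoc]
      exact P.mul_mem (h a b _ _ hab hsub) (ih.1 h1)

theorem altNat_normal : altNat.Normal := by
  refine ⟨?_⟩
  rintro _ ⟨s, τ, hτ, rfl⟩ π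
  let e : {x // x ∈ s} ≃ {x // x ∈ s.map π.toEmbedding} := π.subtypeEquiv (by simp)
  refine ⟨s.map π.toEmbedding, e.permCongr τ, by rw [sign_permCongr, hτ], ?_⟩
  ext1 x
  by_cases hx : π⁻¹ x ∈ s
  · have hx' : x ∈ s.map π.toEmbedding := by simpa using hx
    have he : e.symm ⟨x, hx'⟩ = ⟨π⁻¹ x, hx⟩ := rfl
    rw [ofSubtype_apply_of_mem _ hx', permCongr_apply, he, Perm.mul_apply, Perm.mul_apply,
      ofSubtype_apply_of_mem _ hx]
    rfl
  · have hx' : x ∉ s.map π.toEmbedding := by simpa using hx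
    rw [ofSubtype_apply_of_not_mem _ hx', Perm.mul_apply, Perm.mul_apply,
      ofSubtype_apply_of_not_mem _ hx]
    exact (π.apply_symm_apply x).symm

end Finitary

theorem exists_normal_mulEquiv_altNat_of_le_range {G : Type*} [Group G] {φ : G →* Equiv.Perm ℕ}
    (hφ : Function.Injective φ) (h : altNat ≤ φ.range) :
    ∃ N : Subgroup G, N.Normal ∧ Nonempty (N ≃* altNat) := by
  have := altNat_normal
  refine ⟨altNat.comap φ, inferInstance,
    ⟨MulEquiv.ofBijective (φ.subgroupComap altNat) ⟨fun a b hab => ?_, fun ⟨σ, hσ⟩ => ?_⟩⟩⟩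
  · exact Subtype.ext (hφ (congrArg Subtype.val hab))
  · obtain ⟨g, rfl⟩ := h hσ
    exact ⟨⟨g, hσ⟩, rfl⟩

/-- A countable group with a faithful highly transitive action either has a non-trivial finitary
element, and then a normal copy of `Alt(ℕ)`, or all its non-trivial elements move infinitely many
points. -/
theorem exists_altNat_or_hasInfiniteSupports {G Ω : Type*} [Group G] [Countable G] [MulAction G Ω]
    [FaithfulSMul G Ω] (hG : ∀ k, IsKTransitive G Ω k) :
    (∃ N : Subgroup G, N.Normal ∧ Nonempty (N ≃* altNat)) ∨
      HasInfiniteSupports (MonoidHom.id G) Ω := by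
  classical
  rw [or_iff_not_imp_right]
  intro hfin
  simp only [HasInfiniteSupports, not_forall, Set.not_infinite, MonoidHom.id_apply] at hfin
  obtain ⟨g, hg1, hfin⟩ := hfin
  have hinf := infinite_of_isKTransitive hG
  have hcount : Countable Ω := by
    obtain ⟨p⟩ : Nonempty Ω := inferInstance
    refine (show Function.Surjective fun g : G => g • p from fun q => ?_).countable
    obtain ⟨g, hg⟩ := (hG 1).2 ⟨fun _ => p, Function.injective_of_subsingleton _⟩
      ⟨fun _ => q, Function.injective_of_subsingleton _⟩
    exact ⟨g, hg 0⟩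
  obtain ⟨e⟩ : Nonempty (Ω ≃ ℕ) := nonempty_equiv_of_countable
  let φ : G →* Equiv.Perm ℕ := e.permCongrHom.toMonoidHom.comp (MulAction.toPermHom G Ω)
  have hφ : ∀ g n, φ g n = e (g • e.symm n) := fun g n => rfl
  have hP : ∀ k, IsKTransitive φ.range ℕ k := by
    refine fun k => ⟨⟨Fin.valEmbedding⟩, fun a b => ?_⟩
    obtain ⟨h, hh⟩ := (hG k).2 (a.trans e.symm.toEmbedding) (b.trans e.symm.toEmbedding)
    refine ⟨⟨φ h, h, rfl⟩, fun i => ?_⟩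
    have := congrArg e (hh i)
    simpa [Subgroup.smul_def, hφ] using this
  have hinj : Function.Injective φ :=
    e.permCongrHom.injective.comp MulAction.toPerm_injective
  refine exists_normal_mulEquiv_altNat_of_le_range hinj (altNat_le fun a b c d hab hcd => ?_)
  refine swap_mul_swap_mem (fun x y z hxy hzy hxz => ?_) hab hcd
  refine swap_mul_swap_mem_of_ne hP ⟨g, rfl⟩ (fun h => hg1 (hinj (h.trans (map_one φ).symm)))
    (S := hfin.toFinset.map e.toEmbedding) (fun n hn => ?_) hxy hzy hxz
  rw [hφ, ← e.eq_symm_apply]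
  by_contra hne
  exact hn (Finset.mem_map.2 ⟨e.symm n, by simpa using hne, by simp⟩)

/-! ### A mixed identity from a normal copy of `Alt(ℕ)` -/

theorem pow_factorial_card_eq_one {α : Type*} [DecidableEq α] {σ : Equiv.Perm α} {s : Finset α}
    (h : ∀ x ∉ s, σ x = x) : σ ^ (s.card).factorial = 1 := by
  have hinv : ∀ x, σ x ∈ s ↔ x ∈ s := by
    intro x
    by_cases hx : x ∈ s
    · refine iff_of_true ?_ hx
      by_contra hσ
      have := σ.injective (h _ hσ)
      exact hσ (by rwa [this])
    · rw [h x hx]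
  rw [← Equiv.Perm.ofSubtype_subtypePerm hinv (fun x hx => not_imp_comm.1 (h x) hx), ← map_pow]
  have : s.card.factorial = Fintype.card (Equiv.Perm {x // x ∈ s}) := by
    rw [Fintype.card_perm, Fintype.card_coe]
  rw [this, pow_card_eq_one, map_one]

/-- The product of two conjugates of `σ` moves at most twice as many points as `σ`. -/
theorem conj_mul_self_pow_eq_one {α : Type*} [DecidableEq α] {σ : Equiv.Perm α} {s : Finset α}
    (h : ∀ x ∉ s, σ x = x) (ν : Equiv.Perm α) :
    (ν * σ * ν⁻¹ * σ) ^ (2 * s.card).factorial = 1 := by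
  have hfix : ∀ x ∉ s.map ν.toEmbedding ∪ s, (ν * σ * ν⁻¹ * σ) x = x := by
    intro x hx
    rw [Finset.notMem_union] at hx
    have hν : ν⁻¹ x ∉ s := fun hm => hx.1 (by simpa using hm)
    rw [Equiv.Perm.mul_apply, h x hx.2, Equiv.Perm.mul_apply, Equiv.Perm.mul_apply, h _ hν]
    exact ν.apply_symm_apply x
  refine orderOf_dvd_iff_pow_eq_one.1 ((orderOf_dvd_of_pow_eq_one
    (pow_factorial_card_eq_one hfix)).trans (Nat.factorial_dvd_factorial ?_))
  refine (Finset.card_union_le _ _).trans ?_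
  rw [Finset.card_map, two_mul]

theorem swap_mul_swap_mem_altNat {a b c d : ℕ} (hab : a ≠ b) (hcd : c ≠ d) :
    Equiv.swap a b * Equiv.swap c d ∈ altNat := by
  let s : Finset ℕ := {a, b, c, d}
  let a' : {x // x ∈ s} := ⟨a, by simp [s]⟩
  let b' : {x // x ∈ s} := ⟨b, by simp [s]⟩
  let c' : {x // x ∈ s} := ⟨c, by simp [s]⟩
  let d' : {x // x ∈ s} := ⟨d, by simp [s]⟩
  have hab' : a' ≠ b' := fun h => hab (congrArg Subtype.val h)
  have hcd' : c' ≠ d' := fun h => hcd (congrArg Subtype.val h)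
  refine ⟨s, Equiv.swap a' b' * Equiv.swap c' d', ?_, ?_⟩
  · rw [map_mul, Equiv.Perm.sign_swap hab', Equiv.Perm.sign_swap hcd', neg_mul_neg, one_mul]
  · rw [map_mul, Equiv.Perm.ofSubtype_swap_eq, Equiv.Perm.ofSubtype_swap_eq]

instance infinite_altNat : Infinite altNat := by
  let f : ℕ → altNat := fun k => ⟨Equiv.swap 0 1 * Equiv.swap 0 (k + 2),
    swap_mul_swap_mem_altNat (by simp) (by simp)⟩
  have hf : ∀ k, (f k).1 0 = k + 2 := by
    intro k
    rw [Equiv.Perm.mul_apply, Equiv.swap_apply_left]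
    exact Equiv.swap_apply_of_ne_of_ne (by simp) (by simp)
  refine Infinite.of_injective f fun k l h => ?_
  have := congrArg (fun σ : altNat => σ.1 0) h
  simpa only [hf, Nat.add_right_cancel_iff] using this

/-- The syllables of `y * n * y⁻¹ * n * y * n⁻¹ * y⁻¹ * n`. -/
def conjSyllables {G : Type*} [Group G] (n : G) : List (Fin 1 × Bool × G) :=
  [(0, true, n), (0, false, n), (0, true, n⁻¹), (0, false, n)]

/-- If `N ≅ Alt(ℕ)` is normal in `G` and `n ∈ N` is non-trivial, then for `y ∈ G` the element
`ν = y * n * y⁻¹` lies in `N`, so the order of `ν * n * ν⁻¹ * n` divides a number not depending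
on `y`. -/
theorem not_isMIF_of_altNat {G : Type*} [Group G] {N : Subgroup G} (hN : N.Normal)
    (e : N ≃* altNat) : ¬ IsMIF G := by
  obtain ⟨⟨σ, hσ⟩, hσ1⟩ := exists_ne (1 : altNat)
  obtain ⟨s, hs⟩ : ∃ s : Finset ℕ, ∀ x ∉ s, σ x = x := by
    obtain ⟨s, τ, -, rfl⟩ := hσ
    exact ⟨s, fun x hx => Equiv.Perm.ofSubtype_apply_of_not_mem τ hx⟩
  obtain ⟨⟨n, hn⟩, he⟩ := e.surjective ⟨σ, hσ⟩
  have hn1 : n ≠ 1 := by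
    rintro rfl
    have h1 : e 1 = ⟨σ, hσ⟩ := he
    rw [map_one] at h1
    exact hσ1 h1.symm
  have : Infinite N := e.toEquiv.infinite_iff.2 infinite_altNat
  have : Infinite G := Infinite.of_injective _ N.subtype_injective
  let K := (2 * s.card).factorial
  let L := (List.replicate K (conjSyllables n)).flatten
  have hL : L.IsChain NoCancel := by
    have hall : ∀ t ∈ L, t.2.2 ≠ 1 := by
      intro t ht
      obtain ⟨M, hM, ht⟩ := List.mem_flatten.1 ht
      rw [List.eq_of_mem_replicate hM] at ht
      simp only [conjSyllables, List.mem_cons, List.not_mem_nil, or_false] at ht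
      rcases ht with rfl | rfl | rfl | rfl <;> simpa using hn1
    exact (List.Pairwise.imp_of_mem (fun hs _ _ _ _ => hall _ hs)
      (List.pairwise_of_forall (R := fun _ _ => True) fun _ _ => trivial)).isChain
  have hne : L ≠ [] := by
    have hK : K ≠ 0 := (Nat.factorial_pos _).ne'
    simp [L, hK, conjSyllables]
  intro hMIF
  refine hMIF 1 (ofSyllables 1 L) (ofSyllables_ne_one 1 L hL hne) fun f hf => ?_
  have hfinl : f.comp inl = MonoidHom.id G := MonoidHom.ext hf
  rw [ofSyllables, map_one, one_mul, map_syllableProd, hfinl, syllableProd_flatten_replicate]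
  set y : G := (f ∘ gen G) 0 with hy
  have hprod : syllableProd (MonoidHom.id G) (f ∘ gen G) (conjSyllables n) =
      (y * n * y⁻¹) * n * (y * n * y⁻¹)⁻¹ * n := by
    simp only [conjSyllables, syllableProd, letter, cond_true, cond_false, MonoidHom.id_apply, ← hy]
    group
  rw [hprod]
  let ν : N := ⟨y * n * y⁻¹, hN.conj_mem n hn y⟩
  have hpow : (ν * ⟨n, hn⟩ * ν⁻¹ * ⟨n, hn⟩) ^ K = 1 := by
    apply e.injective
    rw [map_pow, map_one, map_mul, map_mul, map_mul, he, map_inv]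
    exact Subtype.ext (conj_mul_self_pow_eq_one hs (e ν))
  exact congrArg Subtype.val hpow

/-! ### Universal sentences with constants from `G` -/

section Universal

open FirstOrder Language

variable {G H K : Type*} [Group G] [Group H] [Group K]

/-- A homomorphism of `G`-groups, as a homomorphism of structures in the language of `G`-groups. -/
def gHom {ι : G →* H} {κ : G →* K} (f : H →* K) (hf : f.comp ι = κ) :
    letI := gGroupStructure ι
    letI := gGroupStructure κ
    H →[gGroupLanguage G] K :=
  letI := gGroupStructure ι
  letI := gGroupStructure κ
  { toFun := f
    map_fun' := by
      intro n s x
      cases s with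
      | const g => exact DFunLike.congr_fun hf g
      | inv => exact map_inv f (x 0)
      | mul => exact map_mul f (x 0) (x 1)
    map_rel' := fun r _ _ => r.elim }

/-- A `G`-homomorphism `f` preserves the truth of a quantifier-free formula at a given valuation as
soon as it does not kill certain finitely many non-trivial elements, the quotients of the two sides
of the equations that are false in `H`. -/
theorem exists_finset_realize_iff_of_isQF (ι : G →* H) (κ : G →* K) {α : Type*} {n : ℕ}
    {φ : (gGroupLanguage G).BoundedFormula α n} (hφ : φ.IsQF) (v : α → H) (xs : Fin n → H) :
    letI := gGroupStructure ι
    letI := gGroupStructure κ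
    ∃ W : Finset H, (∀ w ∈ W, w ≠ 1) ∧ ∀ f : H →* K, f.comp ι = κ → (∀ w ∈ W, f w ≠ 1) →
      (φ.Realize (f ∘ v) (f ∘ xs) ↔ φ.Realize v xs) := by
  classical
  let := gGroupStructure ι
  let := gGroupStructure κ
  induction hφ with
  | falsum => exact ⟨∅, by simp, fun f _ _ => Iff.rfl⟩
  | of_isAtomic h =>
    cases h with
    | rel R ts => exact R.elim
    | equal t₁ t₂ =>
      let a := t₁.realize (Sum.elim v xs)
      let b := t₂.realize (Sum.elim v xs)
      have hreal : ∀ f : H →* K, f.comp ι = κ → ∀ t : (gGroupLanguage G).Term (α ⊕ Fin n),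
          t.realize (Sum.elim (f ∘ v) (f ∘ xs)) = f (t.realize (Sum.elim v xs)) := by
        intro f hf t
        rw [← Sum.comp_elim]
        exact HomClass.realize_term (gHom f hf)
      refine ⟨if a = b then ∅ else {a / b}, ?_, fun f hf hW => ?_⟩
      · intro w hw
        split_ifs at hw with hab
        · simp at hw
        · rw [Finset.mem_singleton.1 hw]
          exact fun h => hab (div_eq_one.1 h)
      · rw [BoundedFormula.realize_bdEqual, BoundedFormula.realize_bdEqual, hreal f hf, hreal f hf]
        refine ⟨fun h => ?_, fun h => congrArg f h⟩
        by_contra hab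
        refine hW (a / b) (by simp [a, b, hab]) ?_
        rw [map_div]
        exact div_eq_one.2 h
  | imp h₁ h₂ ih₁ ih₂ =>
    obtain ⟨W₁, hW₁, h₁⟩ := ih₁
    obtain ⟨W₂, hW₂, h₂⟩ := ih₂
    refine ⟨W₁ ∪ W₂, fun w hw => (Finset.mem_union.1 hw).elim (hW₁ w) (hW₂ w),
      fun f hf hW => ?_⟩
    rw [BoundedFormula.realize_imp, BoundedFormula.realize_imp,
      h₁ f hf fun w hw => hW w (Finset.mem_union_left _ hw),
      h₂ f hf fun w hw => hW w (Finset.mem_union_right _ hw)]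

/-- A universal formula that fails in `H` fails in `K` as soon as some `G`-homomorphism from `H` to
`K` does not kill certain finitely many non-trivial elements. -/
theorem exists_finset_not_realize_of_isUniversal (ι : G →* H) (κ : G →* K) {α : Type*} {n : ℕ}
    {φ : (gGroupLanguage G).BoundedFormula α n} (hφ : φ.IsUniversal) (v : α → H)
    (xs : Fin n → H) :
    letI := gGroupStructure ι
    letI := gGroupStructure κ
    ¬ φ.Realize v xs → ∃ W : Finset H, (∀ w ∈ W, w ≠ 1) ∧
      ∀ f : H →* K, f.comp ι = κ → (∀ w ∈ W, f w ≠ 1) → ¬ φ.Realize (f ∘ v) (f ∘ xs) := by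
  let := gGroupStructure ι
  let := gGroupStructure κ
  induction hφ with
  | of_isQF h =>
    intro hnot
    obtain ⟨W, hW, hf⟩ := exists_finset_realize_iff_of_isQF ι κ h v xs
    exact ⟨W, hW, fun f hfι hfW hr => hnot ((hf f hfι hfW).1 hr)⟩
  | all _ ih =>
    intro hnot
    rw [BoundedFormula.realize_all, not_forall] at hnot
    obtain ⟨a, ha⟩ := hnot
    obtain ⟨W, hW, hf⟩ := ih (Fin.snoc xs a) ha
    refine ⟨W, hW, fun f hfι hfW hr => hf f hfι hfW ?_⟩
    rw [Fin.comp_snoc]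
    exact hr (f a)

/-- If finitely many non-trivial elements of the `G`-group `H` can always be kept non-trivial by a
`G`-homomorphism to `K`, then the universal sentences true in `K` are true in `H`. -/
theorem universalTheory_subset_of_discriminates {ι : G →* H} {κ : G →* K}
    (h : ∀ W : Finset H, (∀ w ∈ W, w ≠ 1) → ∃ f : H →* K, f.comp ι = κ ∧ ∀ w ∈ W, f w ≠ 1) :
    universalTheory κ ⊆ universalTheory ι := by
  rintro φ ⟨hU, hφ⟩
  refine ⟨hU, ?_⟩
  by_contra hnot
  obtain ⟨W, hW, hf⟩ := exists_finset_not_realize_of_isUniversal ι κ hU default default hnot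
  obtain ⟨f, hfι, hfW⟩ := h W hW
  refine hf f hfι hfW ?_
  rw [Subsingleton.elim (f ∘ default) default, Subsingleton.elim (f ∘ default) default]
  exact hφ

/-- Every element of `G ∗ F_n` is given by a term in the language of `G`-groups. -/
theorem exists_term_realize_eq {G : Type u} [Group G] {n : ℕ}
    (w : Monoid.Coprod G (FreeGroup (Fin n))) :
    ∃ t : (gGroupLanguage G).Term (Empty ⊕ Fin n), ∀ (H : Type u) [Group H] (ι : G →* H)
      (v : Empty → H) (xs : Fin n → H),
      letI := gGroupStructure ι
      t.realize (Sum.elim v xs) = lift ι (FreeGroup.lift xs) w := by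
  induction w using Monoid.Coprod.induction_on with
  | inl g =>
    refine ⟨Term.func (GGroupFunc.const g : (gGroupLanguage G).Functions 0) Fin.elim0, ?_⟩
    intro H _ ι v xs
    rw [Monoid.Coprod.lift_apply_inl]
    rfl
  | inr f =>
    simp only [Monoid.Coprod.lift_apply_inr]
    induction f using FreeGroup.induction_on with
    | C1 =>
      refine ⟨Term.func (GGroupFunc.const 1 : (gGroupLanguage G).Functions 0) Fin.elim0, ?_⟩
      intro H _ ι v xs
      rw [map_one]
      exact map_one ι
    | of i =>
      refine ⟨Term.var (Sum.inr i), ?_⟩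
      intro H _ ι v xs
      rw [FreeGroup.lift_apply_of]
      rfl
    | inv_of i ih =>
      obtain ⟨t, ht⟩ := ih
      refine ⟨Term.func (GGroupFunc.inv : (gGroupLanguage G).Functions 1) ![t], ?_⟩
      intro H _ ι v xs
      rw [map_inv, ← ht H ι v xs]
      rfl
    | mul a b ha hb =>
      obtain ⟨s, hs⟩ := ha
      obtain ⟨t, ht⟩ := hb
      refine ⟨Term.func (GGroupFunc.mul : (gGroupLanguage G).Functions 2) ![s, t], ?_⟩
      intro H _ ι v xs
      rw [map_mul, ← hs H ι v xs, ← ht H ι v xs]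
      rfl
  | mul a b ha hb =>
    obtain ⟨s, hs⟩ := ha
    obtain ⟨t, ht⟩ := hb
    refine ⟨Term.func (GGroupFunc.mul : (gGroupLanguage G).Functions 2) ![s, t], ?_⟩
    intro H _ ι v xs
    rw [map_mul, ← hs H ι v xs, ← ht H ι v xs]
    rfl

theorem isUniversal_alls {L : Language} {α : Type*} {n : ℕ} {φ : L.BoundedFormula α n}
    (h : φ.IsUniversal) : BoundedFormula.IsUniversal φ.alls := by
  induction n with
  | zero => exact h
  | succ n ih => exact ih h.all

/-- A mixed identity `w = 1` of `G` is a universal sentence; if it also holds in `G ∗ F_n`, then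
substituting the free generators gives `w = 1`. -/
theorem isMIF_of_universallyEquivalent {G : Type u} [Group G]
    (h : ∀ n : ℕ, UniversallyEquivalent (MonoidHom.id G)
      (inl : G →* Monoid.Coprod G (FreeGroup (Fin n)))) : IsMIF G := by
  intro n w hw hsat
  obtain ⟨t, ht⟩ := exists_term_realize_eq w
  let c : (gGroupLanguage G).Term (Empty ⊕ Fin n) :=
    Term.func (GGroupFunc.const 1 : (gGroupLanguage G).Functions 0) Fin.elim0
  have hmem : (t.bdEqual c).alls ∈ universalTheory (MonoidHom.id G) := by
    let := gGroupStructure (MonoidHom.id G)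
    refine ⟨isUniversal_alls (BoundedFormula.IsAtomic.equal t c).isUniversal, ?_⟩
    refine BoundedFormula.realize_alls.2 fun xs => ?_
    rw [BoundedFormula.realize_bdEqual, ht]
    exact hsat _ fun g => Monoid.Coprod.lift_apply_inl _ _ g
  rw [h n] at hmem
  let := gGroupStructure (inl : G →* Monoid.Coprod G (FreeGroup (Fin n)))
  have hall := BoundedFormula.realize_alls.1 hmem.2 fun i => inr (FreeGroup.of i)
  rw [BoundedFormula.realize_bdEqual, ht] at hall
  have hid : lift inl (FreeGroup.lift fun i => inr (FreeGroup.of i)) =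
      MonoidHom.id (Monoid.Coprod G (FreeGroup (Fin n))) := by
    refine Monoid.Coprod.hom_ext (MonoidHom.ext fun g => by simp) ?_
    refine FreeGroup.ext_hom _ _ fun i => by simp
  rw [hid] at hall
  exact hw (hall.trans (map_one inl))

theorem universallyEquivalent_of_hasInfiniteSupports {G Ω : Type*} [Group G] [MulAction G Ω]
    (hG : ∀ k, IsKTransitive G Ω k) (hφ : HasInfiniteSupports (MonoidHom.id G) Ω) (n : ℕ) :
    UniversallyEquivalent (MonoidHom.id G)
      (inl : G →* Monoid.Coprod G (FreeGroup (Fin n))) := by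
  refine Set.Subset.antisymm (universalTheory_subset_of_discriminates fun W hW => ?_)
    (universalTheory_subset_of_discriminates fun W hW => ?_)
  · obtain ⟨x, hx⟩ := exists_lift_ne_one hG hφ W hW
    exact ⟨lift (MonoidHom.id G) (FreeGroup.lift x), Monoid.Coprod.lift_comp_inl _ _, hx⟩
  · exact ⟨inl, MonoidHom.comp_id _,
      fun w hw h1 => hW w hw (Monoid.Coprod.inl_injective (h1.trans (map_one inl).symm))⟩

end Universal

end HighlyTransitive

theorem mainTheorem2 {G : Type u} [Group G] [Countable G]
    (hG : IsHighlyTransitive.{u, v} G) :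
    (((∃ N : Subgroup G, N.Normal ∧ Nonempty (N ≃* altNat)) ∨ IsMIF G) ∧
      ¬ ((∃ N : Subgroup G, N.Normal ∧ Nonempty (N ≃* altNat)) ∧ IsMIF G)) ∧
    (IsMIF G ↔ ∀ n : ℕ, UniversallyEquivalent (MonoidHom.id G)
      (Monoid.Coprod.inl : G →* Monoid.Coprod G (FreeGroup (Fin n)))) := by
  obtain ⟨Ω, _, _, hΩ⟩ := hG
  have hdich := HighlyTransitive.exists_altNat_or_hasInfiniteSupports hΩ
  have hexcl : ¬ ((∃ N : Subgroup G, N.Normal ∧ Nonempty (N ≃* altNat)) ∧ IsMIF G) := by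
    rintro ⟨⟨N, hN, ⟨e⟩⟩, hMIF⟩
    exact HighlyTransitive.not_isMIF_of_altNat hN e hMIF
  refine ⟨⟨hdich.imp_right (HighlyTransitive.isMIF_of_hasInfiniteSupports hΩ), hexcl⟩,
    fun hMIF n => ?_, HighlyTransitive.isMIF_of_universallyEquivalent⟩
  exact HighlyTransitive.universallyEquivalent_of_hasInfiniteSupports hΩ
    (hdich.resolve_left fun h => hexcl ⟨h, hMIF⟩) n
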